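/- Let $\mathscr{H}^+$ (the $^+$stable limit double affine Hecke algebra) be the unital associative $\mathbb{Q}(\mathfrak t,\mathfrak q)$-algebra generated by elements $T_i, X_i, Y_i$, $i\ge 1$, subject to the relations $$T_iT_j=T_jT_i\ (|i-j|>1),\qquad T_iT_{i+1}T_i=T_{i+1}T_iT_{i+1},\qquad (T_i-1)(T_i+\mathfrak t)=0,$$ $$\mathfrak t\,T_i^{-1}X_iT_i^{-1}=X_{i+1},\qquad T_iX_j=X_jT_i\ (j\ne i,i+1),\qquad X_iX_j=X_jX_i,$$ $$\mathfrak t^{-1}T_iY_iT_i=Y_{i+1},\qquad T_iY_j=Y_jT_i\ (j\ne i,i+1),\qquad Y_iY_j=Y_jY_i,$$ $$Y_1T_1X_1=X_2Y_1T_1,$$ for all $i,j\ge1$, where $T_i^{-1}=\mathfrak t^{-1}(T_i+\mathfrak t-1)$ is the inverse of $T_i$ provided by the quadratic relation. Let $\mathfrak a,\mathfrak b:\mathscr{H}^+\to\mathscr{H}^+$ be the $\mathbb{Q}(\mathfrak t,\mathfrak q)$-algebra endomorphisms given, for all $i\ge1$, by $$\mathfrak a(T_i)=T_i,\quad \mathfrak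 a(X_i)=X_i,\quad \mathfrak a(Y_i)=\mathfrak t^{\,1-i}(T_{i-1}\cdots T_1)(T_1\cdots T_{i-1})X_iY_i,$$ $$\mathfrak b(T_i)=T_i,\quad \mathfrak b(Y_i)=Y_i,\quad \mathfrak b(X_i)=\mathfrak t^{\,i-1}(T_{i-1}^{-1}\cdots T_1^{-1})(T_1^{-1}\cdots T_{i-1}^{-1})Y_iX_i.$$ Then $\mathfrak a$ and $\mathfrak b$ generate a free monoid on two generators: the submonoid of the monoid of algebra endomorphisms of $\mathscr{H}^+$ (under composition) generated by $\mathfrak a$ and $\mathfrak b$ is free with basis $\{\mathfrak a,\mathfrak b\}$, with $\mathfrak a\neq\mathfrak b$; that is, there is an isomorphism onto it from the free monoid on two letters that sends the two letters to $\mathfrak a$ and $\mathfrak b$. -/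

import Mathlib

namespace StableDAHA

/-! ### The ground field and the algebra -/

/-- The field `ℚ(𝓉, 𝓆)` of rational functions in two parameters. -/
def K : Type := FractionRing (MvPolynomial (Fin 2) ℚ)

noncomputable instance : Field K :=
  inferInstanceAs (Field (FractionRing (MvPolynomial (Fin 2) ℚ)))

noncomputable instance : Algebra (MvPolynomial (Fin 2) ℚ) K :=
  inferInstanceAs (Algebra (MvPolynomial (Fin 2) ℚ) (FractionRing (MvPolynomial (Fin 2) ℚ)))

instance : IsFractionRing (MvPolynomial (Fin 2) ℚ) K :=
  inferInstanceAs (IsFractionRing (MvPolynomial (Fin 2) ℚ) (FractionRing (MvPolynomial (Fin 2) ℚ)))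

/-- The parameter `𝓉`. -/
noncomputable def tc : K := algebraMap (MvPolynomial (Fin 2) ℚ) K (MvPolynomial.X 0)

/-- The parameter `𝓆`. It belongs to the ground field, but no relation involves it. -/
noncomputable def qc : K := algebraMap (MvPolynomial (Fin 2) ℚ) K (MvPolynomial.X 1)

/-- The generators. Indices are shifted by one: `T n`, `X n`, `Y n` stand for
`T_{n+1}`, `X_{n+1}`, `Y_{n+1}`, so that `n : ℕ` runs over all the indices `i = n + 1 ≥ 1`. -/
inductive Gen : Type
  | T (n : ℕ)
  | X (n : ℕ)
  | Y (n : ℕ)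

namespace Free

/-- `T_{n+1}` in the free algebra. -/
noncomputable def T (n : ℕ) : FreeAlgebra K Gen := FreeAlgebra.ι K (Gen.T n)

/-- `X_{n+1}` in the free algebra. -/
noncomputable def X (n : ℕ) : FreeAlgebra K Gen := FreeAlgebra.ι K (Gen.X n)

/-- `Y_{n+1}` in the free algebra. -/
noncomputable def Y (n : ℕ) : FreeAlgebra K Gen := FreeAlgebra.ι K (Gen.Y n)

/-- The element `𝓉⁻¹ (T + 𝓉 - 1)`; the quadratic relation `(T - 1) (T + 𝓉) = 0` says exactly
that it is the inverse of `T`. -/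
noncomputable def Tinv (n : ℕ) : FreeAlgebra K Gen :=
  tc⁻¹ • (T n + algebraMap K (FreeAlgebra K Gen) (tc - 1))

end Free

open Free in
/-- The defining relations of the `+`stable limit DAHA. -/
inductive Rel : FreeAlgebra K Gen → FreeAlgebra K Gen → Prop
  | T_comm (i j : ℕ) (h : i + 1 < j ∨ j + 1 < i) : Rel (T i * T j) (T j * T i)
  | T_braid (i : ℕ) : Rel (T i * T (i + 1) * T i) (T (i + 1) * T i * T (i + 1))
  | quadratic (i : ℕ) : Rel ((T i - 1) * (T i + algebraMap K (FreeAlgebra K Gen) tc)) 0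
  | X_succ (i : ℕ) : Rel (tc • (Tinv i * X i * Tinv i)) (X (i + 1))
  | T_X (i j : ℕ) (h : j ≠ i) (h' : j ≠ i + 1) : Rel (T i * X j) (X j * T i)
  | X_comm (i j : ℕ) : Rel (X i * X j) (X j * X i)
  | Y_succ (i : ℕ) : Rel (tc⁻¹ • (T i * Y i * T i)) (Y (i + 1))
  | T_Y (i j : ℕ) (h : j ≠ i) (h' : j ≠ i + 1) : Rel (T i * Y j) (Y j * T i)
  | Y_comm (i j : ℕ) : Rel (Y i * Y j) (Y j * Y i)
  | cross : Rel (Y 0 * T 0 * X 0) (X 1 * Y 0 * T 0)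

/-- The `+`stable limit double affine Hecke algebra `ℋ⁺`. -/
def H : Type := RingQuot Rel

noncomputable instance : Ring H := inferInstanceAs (Ring (RingQuot Rel))

noncomputable instance : Algebra K H := inferInstanceAs (Algebra K (RingQuot Rel))

/-- The quotient map onto `ℋ⁺`. -/
noncomputable def proj : FreeAlgebra K Gen →ₐ[K] H := RingQuot.mkAlgHom K Rel

/-- `T_{n+1} ∈ ℋ⁺`. -/
noncomputable def T (n : ℕ) : H := proj (Free.T n)

/-- `T_{n+1}⁻¹ ∈ ℋ⁺` (see `T_mul_Tinv` and `Tinv_mul_T`). -/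
noncomputable def Tinv (n : ℕ) : H := proj (Free.Tinv n)

/-- `X_{n+1} ∈ ℋ⁺`. -/
noncomputable def X (n : ℕ) : H := proj (Free.X n)

/-- `Y_{n+1} ∈ ℋ⁺`. -/
noncomputable def Y (n : ℕ) : H := proj (Free.Y n)

/-! ### The images of the generators under the two endomorphisms -/

/-- `u_n ⋯ u_1` (that is, `u (n-1) * ⋯ * u 0` with shifted indices). -/
def descProd {M : Type*} [Monoid M] (u : ℕ → M) (n : ℕ) : M :=
  ((List.range n).reverse.map u).prod

/-- `u_1 ⋯ u_n` (that is, `u 0 * ⋯ * u (n-1)` with shifted indices). -/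
def ascProd {M : Type*} [Monoid M] (u : ℕ → M) (n : ℕ) : M :=
  ((List.range n).map u).prod

/-- Images of the generators under `𝔞`: with `i = n + 1`,
`Y_i ↦ 𝓉^{1-i} (T_{i-1} ⋯ T_1) (T_1 ⋯ T_{i-1}) X_i Y_i`. -/
noncomputable def aGen : Gen → H
  | Gen.T n => T n
  | Gen.X n => X n
  | Gen.Y n => (tc⁻¹) ^ n • (descProd T n * ascProd T n * X n * Y n)

/-- Images of the generators under `𝔟`: with `i = n + 1`,
`X_i ↦ 𝓉^{i-1} (T_{i-1}⁻¹ ⋯ T_1⁻¹) (T_1⁻¹ ⋯ T_{i-1}⁻¹) Y_i X_i`. -/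
noncomputable def bGen : Gen → H
  | Gen.T n => T n
  | Gen.X n => tc ^ n • (descProd Tinv n * ascProd Tinv n * Y n * X n)
  | Gen.Y n => Y n

/-! ### Both assignments respect the defining relations -/

theorem tc_ne_zero : tc ≠ 0 := by
  unfold tc
  rw [Ne, IsFractionRing.to_map_eq_zero_iff]
  exact MvPolynomial.X_ne_zero 0

theorem proj_rel {x y : FreeAlgebra K Gen} (h : Rel x y) : proj x = proj y :=
  RingQuot.mkAlgHom_rel K h

theorem descProd_succ {M : Type*} [Monoid M] (u : ℕ → M) (n : ℕ) :
    descProd u (n + 1) = u n * descProd u n := by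
  simp [descProd, List.range_succ]

theorem ascProd_succ {M : Type*} [Monoid M] (u : ℕ → M) (n : ℕ) :
    ascProd u (n + 1) = ascProd u n * u n := by
  simp [ascProd, List.range_succ]

/-- The relations other than the quadratic one, for elements `t`, `t'` inverse to each other. -/
structure Sys {A : Type*} [Ring A] [Algebra K A] (s : K) (t t' x y : ℕ → A) : Prop where
  s_ne : s ≠ 0
  mul_inv : ∀ i, t i * t' i = 1
  inv_mul : ∀ i, t' i * t i = 1
  t_comm : ∀ i j, i + 1 < j ∨ j + 1 < i → Commute (t i) (t j)
  braid : ∀ i, t i * t (i + 1) * t i = t (i + 1) * t i * t (i + 1)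
  x_succ : ∀ i, x (i + 1) = s • (t' i * x i * t' i)
  t_x : ∀ i j, j ≠ i → j ≠ i + 1 → Commute (t i) (x j)
  x_comm : ∀ i j, Commute (x i) (x j)
  y_succ : ∀ i, y (i + 1) = s⁻¹ • (t i * y i * t i)
  t_y : ∀ i j, j ≠ i → j ≠ i + 1 → Commute (t i) (y j)
  y_comm : ∀ i j, Commute (y i) (y j)
  cross : y 0 * t 0 * x 0 = x 1 * y 0 * t 0

namespace Sys

variable {A : Type*} [Ring A] [Algebra K A] {s : K} {t t' x y : ℕ → A}

theorem inv_commute (h : Sys s t t' x y) {i : ℕ} {z : A} (hz : Commute (t i) z) :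
    Commute (t' i) z := by
  let u : Aˣ := ⟨t i, t' i, h.mul_inv i, h.inv_mul i⟩
  have : Commute (u : A) z := hz
  exact this.units_inv_left

/-- Swapping the roles of `x` and `y` inverts `t` and `s`. -/
theorem flip (h : Sys s t t' x y) : Sys s⁻¹ t' t y x where
  s_ne := inv_ne_zero h.s_ne
  mul_inv := h.inv_mul
  inv_mul := h.mul_inv
  t_comm i j hij := h.inv_commute (h.inv_commute (h.t_comm i j hij).symm).symm
  braid i := by
    let u : ℕ → Aˣ := fun i => ⟨t i, t' i, h.mul_inv i, h.inv_mul i⟩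
    have hb : u i * u (i + 1) * u i = u (i + 1) * u i * u (i + 1) := Units.ext (h.braid i)
    have hb' := congrArg (fun v : Aˣ => ((v⁻¹ : Aˣ) : A)) hb
    simpa [u, mul_assoc] using hb'
  x_succ := h.y_succ
  t_x i j h1 h2 := h.inv_commute (h.t_y i j h1 h2)
  x_comm := h.y_comm
  y_succ i := by rw [inv_inv]; exact h.x_succ i
  t_y i j h1 h2 := h.inv_commute (h.t_x i j h1 h2)
  y_comm := h.x_comm
  cross := by
    have hc := h.cross
    rw [h.x_succ 0] at hc
    have h1 : t 0 * (y 0 * t 0 * x 0) * t' 0 = s • (x 0 * t' 0 * y 0) := by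
      rw [hc]
      simp only [smul_mul_assoc, mul_smul_comm]
      congr 1
      calc t 0 * (t' 0 * x 0 * t' 0 * y 0 * t 0) * t' 0
          = (t 0 * t' 0) * x 0 * t' 0 * y 0 * (t 0 * t' 0) := by noncomm_ring
        _ = _ := by rw [h.mul_inv]; simp
    have h2 : y 1 = s⁻¹ • (t 0 * y 0 * t 0) := h.y_succ 0
    rw [h2]
    calc x 0 * t' 0 * y 0 = s⁻¹ • (s • (x 0 * t' 0 * y 0)) := by
            rw [smul_smul, inv_mul_cancel₀ h.s_ne, one_smul]
      _ = s⁻¹ • (t 0 * (y 0 * t 0 * x 0) * t' 0) := by rw [h1]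
      _ = _ := by simp only [smul_mul_assoc, mul_assoc]

/-- The twisted family replacing `y`. -/
noncomputable def tw (s : K) (t x y : ℕ → A) (n : ℕ) : A :=
  (s⁻¹) ^ n • (descProd t n * ascProd t n * x n * y n)

theorem tw_zero : tw s t x y 0 = x 0 * y 0 := by simp [tw, descProd, ascProd]

theorem tw_succ (h : Sys s t t' x y) (n : ℕ) :
    tw s t x y (n + 1) = s⁻¹ • (t n * tw s t x y n * t n) := by
  unfold tw
  rw [descProd_succ, ascProd_succ, h.x_succ, h.y_succ]
  simp only [smul_mul_assoc, mul_smul_comm, smul_smul]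
  congr 1
  · rw [pow_succ]
    field_simp [h.s_ne]
  · calc t n * descProd t n * (ascProd t n * t n) * (t' n * x n * t' n) * (t n * y n * t n)
        = t n * descProd t n * ascProd t n * (t n * t' n) * x n * (t' n * t n) * y n * t n := by
          noncomm_ring
      _ = _ := by rw [h.mul_inv, h.inv_mul]; simp [mul_assoc]

theorem t_tw_of_lt (h : Sys s t t' x y) (i j : ℕ) (hij : j < i) :
    Commute (t i) (tw s t x y j) := by
  induction j with
  | zero =>
    rw [tw_zero]
    exact (h.t_x i 0 (by omega) (by omega)).mul_right (h.t_y i 0 (by omega) (by omega))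
  | succ j ih =>
    rw [h.tw_succ]
    have h1 := h.t_comm i j (Or.inr hij)
    exact ((h1.mul_right (ih (by omega))).mul_right h1).smul_right _

theorem t_tw_add_two (h : Sys s t t' x y) (i : ℕ) : Commute (t i) (tw s t x y (i + 2)) := by
  rw [h.tw_succ (i + 1), h.tw_succ i]
  have hz : t (i + 1) * tw s t x y i = tw s t x y i * t (i + 1) :=
    h.t_tw_of_lt (i + 1) i (by omega)
  set z := tw s t x y i
  have hb := h.braid i
  set a := t i
  set b := t (i + 1)
  simp only [smul_mul_assoc, mul_smul_comm]
  refine (Commute.smul_right ?_ _).smul_right _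
  change a * (b * (a * z * a) * b) = b * (a * z * a) * b * a
  calc a * (b * (a * z * a) * b) = (a * b * a) * z * a * b := by noncomm_ring
    _ = b * a * (b * z) * a * b := by rw [hb]; noncomm_ring
    _ = b * a * z * (b * a * b) := by rw [hz]; noncomm_ring
    _ = b * (a * z * a) * b * a := by rw [← hb]; noncomm_ring

theorem t_tw (h : Sys s t t' x y) (i j : ℕ) (h1 : j ≠ i) (h2 : j ≠ i + 1) :
    Commute (t i) (tw s t x y j) := by
  rcases Nat.lt_or_gt_of_ne h1 with hlt | hgt
  · exact h.t_tw_of_lt i j hlt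
  · obtain ⟨k, rfl⟩ : ∃ k, j = i + 2 + k := ⟨j - (i + 2), by omega⟩
    clear h1 h2 hgt
    induction k with
    | zero => exact h.t_tw_add_two i
    | succ k ih =>
      rw [← add_assoc, h.tw_succ]
      have hc := h.t_comm i (i + 2 + k) (Or.inl (by omega))
      exact ((hc.mul_right ih).mul_right hc).smul_right _

theorem tw_zero_one (h : Sys s t t' x y) : Commute (tw s t x y 0) (tw s t x y 1) := by
  rw [h.tw_succ 0, tw_zero]
  refine Commute.smul_right ?_ _
  have hx1 : x 1 = s • (t' 0 * x 0 * t' 0) := h.x_succ 0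
  have hy1 : y 1 = s⁻¹ • (t 0 * y 0 * t 0) := h.y_succ 0
  have hc := h.cross
  have hxx : x 0 * x 1 = x 1 * x 0 := h.x_comm 0 1
  have hyy : y 0 * (t 0 * y 0 * t 0) = t 0 * y 0 * t 0 * y 0 := by
    have := (h.y_comm 0 1).smul_right s
    rw [hy1, smul_smul, mul_inv_cancel₀ h.s_ne, one_smul] at this
    exact this
  have hct : t 0 * (x 0 * x 1) = x 0 * x 1 * t 0 := by
    rw [hxx]
    nth_rewrite 1 [hx1]
    rw [← hxx, hx1]
    simp only [smul_mul_assoc, mul_smul_comm]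
    congr 1
    calc t 0 * (t' 0 * x 0 * t' 0 * x 0) = (t 0 * t' 0) * x 0 * t' 0 * x 0 := by noncomm_ring
      _ = x 0 * t' 0 * x 0 * (t' 0 * t 0) := by rw [h.mul_inv, h.inv_mul]; simp
      _ = x 0 * (t' 0 * x 0 * t' 0) * t 0 := by noncomm_ring
  change x 0 * y 0 * (t 0 * (x 0 * y 0) * t 0) = t 0 * (x 0 * y 0) * t 0 * (x 0 * y 0)
  symm
  calc t 0 * (x 0 * y 0) * t 0 * (x 0 * y 0)
      = t 0 * x 0 * (y 0 * t 0 * x 0) * y 0 := by noncomm_ring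
    _ = t 0 * (x 0 * x 1) * y 0 * t 0 * y 0 := by rw [hc]; noncomm_ring
    _ = x 0 * x 1 * (t 0 * y 0 * t 0 * y 0) := by rw [hct]; noncomm_ring
    _ = x 0 * (x 1 * y 0 * t 0) * y 0 * t 0 := by rw [← hyy]; noncomm_ring
    _ = x 0 * y 0 * (t 0 * (x 0 * y 0) * t 0) := by rw [← hc]; noncomm_ring

theorem tw_comm_lt (h : Sys s t t' x y) (i j : ℕ) (hij : i < j) :
    Commute (tw s t x y i) (tw s t x y j) := by
  induction i with
  | zero =>
    obtain ⟨k, rfl⟩ : ∃ k, j = k + 1 := ⟨j - 1, by omega⟩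
    clear hij
    induction k with
    | zero => exact h.tw_zero_one
    | succ k ih =>
      rw [h.tw_succ (k + 1)]
      have hc := (h.t_tw (k + 1) 0 (by omega) (by omega)).symm
      exact ((hc.mul_right ih).mul_right hc).smul_right _
  | succ i ih =>
    rw [h.tw_succ i]
    have hc := h.t_tw i j (by omega) (by omega)
    exact ((hc.mul_left (ih (by omega))).mul_left hc).smul_left _

theorem tw_comm (h : Sys s t t' x y) (i j : ℕ) :
    Commute (tw s t x y i) (tw s t x y j) := by
  rcases lt_trichotomy i j with hij | rfl | hij
  · exact h.tw_comm_lt i j hij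
  · exact Commute.refl _
  · exact (h.tw_comm_lt j i hij).symm

/-- The relations are preserved when `y` is replaced by the twisted family. -/
theorem twist (h : Sys s t t' x y) : Sys s t t' x (tw s t x y) where
  s_ne := h.s_ne
  mul_inv := h.mul_inv
  inv_mul := h.inv_mul
  t_comm := h.t_comm
  braid := h.braid
  x_succ := h.x_succ
  t_x := h.t_x
  x_comm := h.x_comm
  y_succ := h.tw_succ
  t_y := h.t_tw
  y_comm := h.tw_comm
  cross := by
    have hxx : x 0 * x 1 = x 1 * x 0 := h.x_comm 0 1
    rw [tw_zero]
    calc x 0 * y 0 * t 0 * x 0 = x 0 * (y 0 * t 0 * x 0) := by noncomm_ring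
      _ = x 0 * x 1 * y 0 * t 0 := by rw [h.cross]; noncomm_ring
      _ = x 1 * (x 0 * y 0) * t 0 := by rw [hxx]; noncomm_ring

end Sys

theorem T_quadratic (n : ℕ) : (T n - 1) * (T n + algebraMap K H tc) = 0 := by
  simpa [T] using proj_rel (Rel.quadratic n)

theorem Tinv_eq (n : ℕ) : Tinv n = tc⁻¹ • (T n + algebraMap K H (tc - 1)) := by
  simp only [Tinv, Free.Tinv, T, map_smul, map_add, AlgHom.commutes]

theorem T_mul_Tinv (n : ℕ) : T n * Tinv n = 1 := by
  have h := T_quadratic n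
  have h' : T n * (T n + algebraMap K H (tc - 1)) = algebraMap K H tc := by
    rw [map_sub, map_one]
    rw [← sub_eq_zero, ← h]
    simp only [mul_add, mul_sub, sub_mul, one_mul, mul_one]
    abel
  rw [Tinv_eq, mul_smul_comm, h', Algebra.smul_def, ← map_mul, inv_mul_cancel₀ tc_ne_zero,
    map_one]

theorem Tinv_mul_T (n : ℕ) : Tinv n * T n = 1 := by
  rw [← T_mul_Tinv n, Tinv_eq]
  simp only [smul_mul_assoc, mul_smul_comm, add_mul, mul_add, Algebra.commutes]

/-- The generators of `ℋ⁺` satisfy the relations. -/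
theorem sys : Sys tc T Tinv X Y where
  s_ne := tc_ne_zero
  mul_inv := T_mul_Tinv
  inv_mul := Tinv_mul_T
  t_comm i j h := by
    simpa [T, Commute, SemiconjBy] using proj_rel (Rel.T_comm i j h)
  braid i := by simpa [T] using proj_rel (Rel.T_braid i)
  x_succ i := by simpa [X, Tinv] using (proj_rel (Rel.X_succ i)).symm
  t_x i j h h' := by
    simpa [T, X, Commute, SemiconjBy] using proj_rel (Rel.T_X i j h h')
  x_comm i j := by simpa [X, Commute, SemiconjBy] using proj_rel (Rel.X_comm i j)
  y_succ i := by simpa [Y, T] using (proj_rel (Rel.Y_succ i)).symm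
  t_y i j h h' := by
    simpa [T, Y, Commute, SemiconjBy] using proj_rel (Rel.T_Y i j h h')
  y_comm i j := by simpa [Y, Commute, SemiconjBy] using proj_rel (Rel.Y_comm i j)
  cross := by simpa [T, X, Y] using proj_rel Rel.cross

/-- Images of the generators that fix every `T` and satisfy the relations respect `Rel`. -/
theorem lift_rel (g : Gen → H) (hT : ∀ n, g (Gen.T n) = T n)
    (h : Sys tc T Tinv (fun n => g (Gen.X n)) (fun n => g (Gen.Y n)))
    ⦃u v : FreeAlgebra K Gen⦄ (r : Rel u v) :
    FreeAlgebra.lift K g u = FreeAlgebra.lift K g v := by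
  have eT : ∀ n, FreeAlgebra.lift K g (Free.T n) = T n := fun n => by simp [Free.T, hT]
  have eX : ∀ n, FreeAlgebra.lift K g (Free.X n) = g (Gen.X n) := fun n => by simp [Free.X]
  have eY : ∀ n, FreeAlgebra.lift K g (Free.Y n) = g (Gen.Y n) := fun n => by simp [Free.Y]
  have eI : ∀ n, FreeAlgebra.lift K g (Free.Tinv n) = Tinv n := fun n => by
    rw [Tinv_eq]
    simp only [Free.Tinv, map_smul, map_add, AlgHom.commutes, eT]
  induction r with
  | T_comm i j hij => simpa only [map_mul, eT] using (h.t_comm i j hij).eq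
  | T_braid i => simpa only [map_mul, eT] using h.braid i
  | quadratic i =>
    simpa only [map_mul, map_sub, map_add, map_one, map_zero, AlgHom.commutes, eT]
      using T_quadratic i
  | X_succ i => simpa only [map_mul, map_smul, eI, eX] using (h.x_succ i).symm
  | T_X i j h1 h2 => simpa only [map_mul, eT, eX] using (h.t_x i j h1 h2).eq
  | X_comm i j => simpa only [map_mul, eX] using (h.x_comm i j).eq
  | Y_succ i => simpa only [map_mul, map_smul, eT, eY] using (h.y_succ i).symm
  | T_Y i j h1 h2 => simpa only [map_mul, eT, eY] using (h.t_y i j h1 h2).eq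
  | Y_comm i j => simpa only [map_mul, eY] using (h.y_comm i j).eq
  | cross => simpa only [map_mul, eT, eX, eY] using h.cross

theorem aGen_rel ⦃u v : FreeAlgebra K Gen⦄ (r : Rel u v) :
    FreeAlgebra.lift K aGen u = FreeAlgebra.lift K aGen v :=
  lift_rel aGen (fun _ => rfl) sys.twist r

theorem bGen_rel ⦃u v : FreeAlgebra K Gen⦄ (r : Rel u v) :
    FreeAlgebra.lift K bGen u = FreeAlgebra.lift K bGen v := by
  refine lift_rel bGen (fun _ => rfl) ?_ r
  have h := sys.flip.twist.flip
  simp only [inv_inv] at h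
  have e : (fun n => bGen (Gen.X n)) = Sys.tw tc⁻¹ Tinv Y X := by
    funext n
    simp only [bGen, Sys.tw, inv_inv]
  rw [e]
  exact h

/-! ### The endomorphisms -/

/-- The endomorphism `𝔞` of `ℋ⁺`. -/
noncomputable def fa : H →ₐ[K] H :=
  RingQuot.liftAlgHom K ⟨FreeAlgebra.lift K aGen, aGen_rel⟩

/-- The endomorphism `𝔟` of `ℋ⁺`. -/
noncomputable def fb : H →ₐ[K] H :=
  RingQuot.liftAlgHom K ⟨FreeAlgebra.lift K bGen, bGen_rel⟩

theorem fa_proj (u : FreeAlgebra K Gen) : fa (proj u) = FreeAlgebra.lift K aGen u :=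
  RingQuot.liftAlgHom_mkAlgHom_apply K _ aGen_rel u

theorem fb_proj (u : FreeAlgebra K Gen) : fb (proj u) = FreeAlgebra.lift K bGen u :=
  RingQuot.liftAlgHom_mkAlgHom_apply K _ bGen_rel u

theorem fa_T (n : ℕ) : fa (T n) = T n :=
  (fa_proj _).trans (FreeAlgebra.lift_ι_apply _ _)

theorem fa_X (n : ℕ) : fa (X n) = X n :=
  (fa_proj _).trans (FreeAlgebra.lift_ι_apply _ _)

theorem fa_Y (n : ℕ) :
    fa (Y n) = (tc⁻¹) ^ n • (descProd T n * ascProd T n * X n * Y n) :=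
  (fa_proj _).trans (FreeAlgebra.lift_ι_apply _ _)

theorem fb_T (n : ℕ) : fb (T n) = T n :=
  (fb_proj _).trans (FreeAlgebra.lift_ι_apply _ _)

theorem fb_Y (n : ℕ) : fb (Y n) = Y n :=
  (fb_proj _).trans (FreeAlgebra.lift_ι_apply _ _)

theorem fb_X (n : ℕ) :
    fb (X n) = tc ^ n • (descProd Tinv n * ascProd Tinv n * Y n * X n) :=
  (fb_proj _).trans (FreeAlgebra.lift_ι_apply _ _)

end StableDAHA

/-! Write `x = X_1` and `y = Y_1`. The endomorphism `𝔞` fixes `x` and sends `y` to `xy`, while `𝔟`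
fixes `y` and sends `x` to `yx`; hence they carry products of `m` copies of `x` and `n` of `y` to
such products with `(m + n, n)`, respectively `(m, m + n)`, copies. Applied to `xy`, a word in `𝔞`
and `𝔟` therefore produces the vertex of the Calkin–Wilf tree reached from `(1, 1)` along that word,
and the path to a vertex of a tree is unique: the last step is recovered by comparing the two
entries. That `m` and `n` are determined by the element of `ℋ⁺` is seen in the representation where
all `T_i` act by `1` and `x`, `y` act as the generators of the quantum plane `yx = 𝓉xy`: there the
monomials `x^m y^n` are linearly independent. -/

namespace StableDAHA

section FreeMonoid

theorem foldr_injective {α β : Type*} {f : α → β → β} {b : β}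
    (hf : Function.Injective (Function.uncurry f)) (hb : ∀ a c, f a c ≠ b) :
    Function.Injective (List.foldr f b) := by
  intro l
  induction l with
  | nil =>
    rintro (_ | ⟨a, l'⟩) h
    · rfl
    · exact absurd h.symm (hb a _)
  | cons a l ih =>
    rintro (_ | ⟨a', l'⟩) h
    · exact absurd h (hb a _)
    · have hcons : (a, l.foldr f b) = (a', l'.foldr f b) := hf h
      obtain ⟨rfl, htail⟩ := Prod.ext_iff.mp hcons
      rw [ih htail]

theorem exists_mulEquiv_closure_of_lift_injective {α N : Type*} [Monoid N] {f : α → N}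
    (hf : Function.Injective (FreeMonoid.lift f)) :
    ∃ e : FreeMonoid α ≃* Submonoid.closure (Set.range f),
      ∀ a, (e (FreeMonoid.of a) : N) = f a :=
  ⟨(MulEquiv.ofBijective (FreeMonoid.lift f).mrangeRestrict
      ⟨fun _ _ h => hf (congrArg Subtype.val h),
        (FreeMonoid.lift f).mrangeRestrict_surjective⟩).trans
      (MulEquiv.submonoidCongr (FreeMonoid.mrange_lift f)),
    fun a => FreeMonoid.lift_eval_of f a⟩

end FreeMonoid

section CalkinWilf

/-- The two maps from a vertex of the Calkin–Wilf tree to its children. The fraction `m / n` is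
encoded as the pair `(m, n)`, and the letters `0` and `1` add the second entry to the first and
the first to the second. -/
def calkinWilfStep : Fin 2 → ℕ+ × ℕ+ → ℕ+ × ℕ+
  | 0, p => (p.1 + p.2, p.2)
  | 1, p => (p.1, p.1 + p.2)

theorem uncurry_calkinWilfStep_injective :
    Function.Injective (Function.uncurry calkinWilfStep) := by
  rintro ⟨i, m, n⟩ ⟨j, m', n'⟩ h
  have := m.pos
  have := n.pos
  have := m'.pos
  have := n'.pos
  fin_cases i <;> fin_cases j <;>
    simp only [Function.uncurry, calkinWilfStep, Prod.mk.injEq, ← PNat.coe_inj, PNat.add_coe,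
      Fin.zero_eta, Fin.mk_one, zero_ne_one, one_ne_zero, true_and] at h ⊢ <;> omega

theorem calkinWilfStep_ne_one_one (i : Fin 2) (p : ℕ+ × ℕ+) : calkinWilfStep i p ≠ (1, 1) := by
  obtain ⟨m, n⟩ := p
  have := m.pos
  have := n.pos
  fin_cases i <;>
    simp only [calkinWilfStep, ne_eq, Prod.mk.injEq, ← PNat.coe_inj, PNat.add_coe,
      PNat.val_ofNat] <;> omega

theorem foldr_calkinWilfStep_injective :
    Function.Injective (List.foldr calkinWilfStep (1, 1)) :=
  foldr_injective uncurry_calkinWilfStep_injective calkinWilfStep_ne_one_one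

end CalkinWilf

/-- `IsWord x y (m, n) z` says that `z` is a nonempty product, in some order, of `m` factors `x` and
`n` factors `y`. The same `z` may have several bidegrees `(m, n)`. -/
inductive IsWord {M : Type*} [Mul M] (x y : M) : ℕ × ℕ → M → Prop
  | left : IsWord x y (1, 0) x
  | right : IsWord x y (0, 1) y
  | mul {d e : ℕ × ℕ} {z w : M} (hz : IsWord x y d z) (hw : IsWord x y e w) :
      IsWord x y (d + e) (z * w)

namespace IsWord

theorem map {M N F : Type*} [Mul M] [Mul N] [FunLike F M N] [MulHomClass F M N] {x y z : M}
    {d : ℕ × ℕ} (h : IsWord x y d z) (f : F) : IsWord (f x) (f y) d (f z) := by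
  induction h with
  | left => exact left
  | right => exact right
  | mul _ _ hz hw => simpa only [map_mul] using hz.mul hw

theorem swap {M : Type*} [Mul M] {x y z : M} {d : ℕ × ℕ} (h : IsWord x y d z) :
    IsWord y x d.swap z := by
  induction h with
  | left => exact right
  | right => exact left
  | mul _ _ hz hw => exact hz.mul hw

section Action

variable {N M : Type*} [Monoid N] [Monoid M] [MulDistribMulAction N M] {a b : N} {x y z : M}
  {d : ℕ × ℕ}

theorem smul_of_smul_right_eq_mul (h : IsWord x y d z) (hx : a • x = x) (hy : a • y = x * y) :
    IsWord x y (d.1 + d.2, d.2) (a • z) := by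
  induction h with
  | left => simpa only [hx] using left
  | right => exact hy ▸ left.mul right
  | @mul d e _ _ _ _ hz hw =>
    rw [smul_mul', Prod.fst_add, Prod.snd_add, add_add_add_comm]
    exact hz.mul hw

theorem smul_of_smul_left_eq_mul (h : IsWord x y d z) (hx : a • x = y * x) (hy : a • y = y) :
    IsWord x y (d.1, d.1 + d.2) (a • z) := by
  simpa only [Prod.swap, add_comm d.2] using (h.swap.smul_of_smul_right_eq_mul hy hx).swap

theorem lift_smul (hax : a • x = x) (hay : a • y = x * y) (hbx : b • x = y * x)
    (hby : b • y = y) (w : FreeMonoid (Fin 2)) :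
    IsWord x y (Prod.map (↑) (↑) (w.toList.foldr calkinWilfStep (1, 1)))
      (FreeMonoid.lift ![a, b] w • (x * y)) := by
  induction w using FreeMonoid.inductionOn' with
  | one => exact (one_smul N (x * y)).symm ▸ left.mul right
  | of_mul i w ih =>
    rw [FreeMonoid.toList_of_mul, List.foldr_cons, map_mul, FreeMonoid.lift_eval_of, mul_smul]
    fin_cases i
    · exact ih.smul_of_smul_right_eq_mul hax hay
    · exact ih.smul_of_smul_left_eq_mul hbx hby

theorem lift_injective_of_bidegree_unique
    (hdeg : ∀ {d e z}, IsWord x y d z → IsWord x y e z → d = e) (hax : a • x = x)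
    (hay : a • y = x * y) (hbx : b • x = y * x) (hby : b • y = y) :
    Function.Injective (FreeMonoid.lift ![a, b]) := by
  intro v w h
  have hv := lift_smul hax hay hbx hby v
  have hw := lift_smul hax hay hbx hby w
  rw [h] at hv
  exact FreeMonoid.toList.injective <| foldr_calkinWilfStep_injective <|
    (PNat.coe_injective.prodMap PNat.coe_injective) (hdeg hv hw)

end Action

end IsWord

section QuantumPlane

variable {R : Type*} [CommSemiring R]

/-- The generator `x` of the quantum plane `yx = t xy`, acting on the free module with basis the
monomials `x ^ m * y ^ n`. The basis vector of `x ^ m * y ^ n` is `Finsupp.single (m, n) 1`. -/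
noncomputable def quantumX (R : Type*) [CommSemiring R] : Module.End R (ℕ × ℕ →₀ R) :=
  Finsupp.linearCombination R fun p => Finsupp.single (p + (1, 0)) 1

/-- The generator `y` of the quantum plane `yx = t xy`, acting on the same module as `quantumX`. -/
noncomputable def quantumY (t : R) : Module.End R (ℕ × ℕ →₀ R) :=
  Finsupp.linearCombination R fun p => Finsupp.single (p + (0, 1)) (t ^ p.1)

theorem quantumX_single (p : ℕ × ℕ) (c : R) :
    quantumX R (Finsupp.single p c) = Finsupp.single (p + (1, 0)) c := by
  simp [quantumX]

theorem quantumY_single (t : R) (p : ℕ × ℕ) (c : R) :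
    quantumY t (Finsupp.single p c) = Finsupp.single (p + (0, 1)) (c * t ^ p.1) := by
  simp [quantumY]

theorem quantumY_mul_quantumX (t : R) :
    quantumY t * quantumX R = t • (quantumX R * quantumY t) := by
  refine Finsupp.lhom_ext fun p c => ?_
  simp only [Module.End.mul_apply, LinearMap.smul_apply, quantumX_single, quantumY_single,
    Finsupp.smul_single, add_right_comm, Prod.fst_add, smul_eq_mul]
  exact congrArg _ (by ring)

theorem IsWord.exists_quantum_apply_single {t : R} {d : ℕ × ℕ} {z : Module.End R (ℕ × ℕ →₀ R)}
    (h : IsWord (quantumX R) (quantumY t) d z) (p : ℕ × ℕ) (k : ℕ) :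
    ∃ l, z (Finsupp.single p (t ^ k)) = Finsupp.single (p + d) (t ^ l) := by
  induction h generalizing p k with
  | left => exact ⟨k, quantumX_single p _⟩
  | right => exact ⟨k + p.1, by rw [quantumY_single, pow_add]⟩
  | @mul d e _ _ _ _ hz hw =>
    obtain ⟨l, hl⟩ := hw p k
    obtain ⟨l', hl'⟩ := hz (p + e) l
    exact ⟨l', by rw [Module.End.mul_apply, hl, hl', add_assoc, add_comm e]⟩

theorem IsWord.bidegree_unique_quantum [IsReduced R] {t : R} (ht : t ≠ 0) {d e : ℕ × ℕ}
    {z : Module.End R (ℕ × ℕ →₀ R)} (hd : IsWord (quantumX R) (quantumY t) d z)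
    (he : IsWord (quantumX R) (quantumY t) e z) : d = e := by
  obtain ⟨k, hk⟩ := hd.exists_quantum_apply_single 0 0
  obtain ⟨l, hl⟩ := he.exists_quantum_apply_single 0 0
  rw [hk, zero_add, zero_add] at hl
  rcases Finsupp.single_eq_single_iff _ _ _ _ |>.mp hl with ⟨hde, -⟩ | ⟨hzero, -⟩
  · exact hde
  · exact absurd hzero (pow_ne_zero k ht)

end QuantumPlane

section Representation

variable {A : Type*} [Ring A] [Algebra K A] {x y : A}

/-- The images of the generators of `ℋ⁺` in a quotient where all `T_i` become `1`; the relations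
then force `X_i = 𝓉^{i-1} X_1` and `Y_i = 𝓉^{1-i} Y_1`. -/
noncomputable def qCommGen (x y : A) : Gen → A
  | Gen.T _ => 1
  | Gen.X n => tc ^ n • x
  | Gen.Y n => tc⁻¹ ^ n • y

theorem lift_qCommGen_Tinv (n : ℕ) : FreeAlgebra.lift K (qCommGen x y) (Free.Tinv n) = 1 := by
  have hsum : (1 : A) + algebraMap K A (tc - 1) = tc • 1 := by
    rw [map_sub, map_one, add_sub_cancel, Algebra.algebraMap_eq_smul_one]
  simp only [Free.Tinv, Free.T, map_smul, map_add, AlgHom.commutes, FreeAlgebra.lift_ι_apply,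
    qCommGen, hsum, inv_smul_smul₀ tc_ne_zero]

theorem lift_qCommGen_rel (hxy : y * x = tc • (x * y)) ⦃u v : FreeAlgebra K Gen⦄ (r : Rel u v) :
    FreeAlgebra.lift K (qCommGen x y) u = FreeAlgebra.lift K (qCommGen x y) v := by
  have hT (n : ℕ) : FreeAlgebra.lift K (qCommGen x y) (Free.T n) = 1 :=
    FreeAlgebra.lift_ι_apply _ _
  have hX (n : ℕ) : FreeAlgebra.lift K (qCommGen x y) (Free.X n) = tc ^ n • x :=
    FreeAlgebra.lift_ι_apply _ _
  have hY (n : ℕ) : FreeAlgebra.lift K (qCommGen x y) (Free.Y n) = tc⁻¹ ^ n • y :=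
    FreeAlgebra.lift_ι_apply _ _
  induction r with
  | T_comm i j | T_braid i => simp only [map_mul, hT]
  | quadratic i => simp only [map_mul, map_sub, map_one, map_zero, hT, sub_self, zero_mul]
  | X_succ i =>
    simp only [map_smul, map_mul, lift_qCommGen_Tinv, hX, one_mul, mul_one, smul_smul, pow_succ']
  | Y_succ i => simp only [map_smul, map_mul, hT, hY, one_mul, mul_one, smul_smul, pow_succ']
  | T_X i j | T_Y i j => simp only [map_mul, hT, hX, hY, one_mul, mul_one]
  | X_comm i j => simp only [map_mul, hX, smul_mul_smul_comm, mul_comm]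
  | Y_comm i j => simp only [map_mul, hY, smul_mul_smul_comm, mul_comm]
  | cross =>
    simp only [map_mul, hT, hX, hY, mul_one, pow_zero, pow_one, one_smul, hxy, smul_mul_assoc]

/-- The homomorphism from `ℋ⁺` sending every `T_i` to `1`, `X_1` to `x` and `Y_1` to `y`. -/
noncomputable def qCommLift (hxy : y * x = tc • (x * y)) : H →ₐ[K] A :=
  RingQuot.liftAlgHom K ⟨FreeAlgebra.lift K (qCommGen x y), lift_qCommGen_rel hxy⟩

theorem qCommLift_proj (hxy : y * x = tc • (x * y)) (u : FreeAlgebra K Gen) :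
    qCommLift hxy (proj u) = FreeAlgebra.lift K (qCommGen x y) u :=
  RingQuot.liftAlgHom_mkAlgHom_apply K _ (lift_qCommGen_rel hxy) u

theorem qCommLift_X_zero (hxy : y * x = tc • (x * y)) : qCommLift hxy (X 0) = x := by
  simp [X, Free.X, qCommLift_proj, qCommGen]

theorem qCommLift_Y_zero (hxy : y * x = tc • (x * y)) : qCommLift hxy (Y 0) = y := by
  simp [Y, Free.Y, qCommLift_proj, qCommGen]

end Representation

theorem IsWord.bidegree_unique_X_Y {d e : ℕ × ℕ} {z : H} (hd : IsWord (X 0) (Y 0) d z)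
    (he : IsWord (X 0) (Y 0) e z) : d = e := by
  have hd' := hd.map (qCommLift (A := Module.End K (ℕ × ℕ →₀ K)) (quantumY_mul_quantumX tc))
  have he' := he.map (qCommLift (A := Module.End K (ℕ × ℕ →₀ K)) (quantumY_mul_quantumX tc))
  rw [qCommLift_X_zero, qCommLift_Y_zero] at hd' he'
  exact hd'.bidegree_unique_quantum tc_ne_zero he'

instance algHomMulSemiringAction {R A : Type*} [CommSemiring R] [Semiring A] [Algebra R A] :
    MulSemiringAction (A →ₐ[R] A) A where
  smul f a := f a
  one_smul _ := rfl
  mul_smul _ _ _ := rfl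
  smul_zero := map_zero
  smul_add := map_add
  smul_one := map_one
  smul_mul := map_mul

theorem fa_Y_zero : fa (Y 0) = X 0 * Y 0 := by
  simp [fa_Y, descProd, ascProd]

theorem fb_X_zero : fb (X 0) = Y 0 * X 0 := by
  simp [fb_X, descProd, ascProd]

theorem lift_fa_fb_injective : Function.Injective (FreeMonoid.lift ![fa, fb]) :=
  IsWord.lift_injective_of_bidegree_unique IsWord.bidegree_unique_X_Y
    (fa_X 0) fa_Y_zero fb_X_zero (fb_Y 0)

end StableDAHA

theorem mainTheorem8 :
    ∃ e : FreeMonoid (Fin 2) ≃*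
        Submonoid.closure
          ({StableDAHA.fa, StableDAHA.fb} : Set (StableDAHA.H →ₐ[StableDAHA.K] StableDAHA.H)),
      (e (FreeMonoid.of 0) : StableDAHA.H →ₐ[StableDAHA.K] StableDAHA.H) = StableDAHA.fa ∧
      (e (FreeMonoid.of 1) : StableDAHA.H →ₐ[StableDAHA.K] StableDAHA.H) = StableDAHA.fb := by
  have hfree := StableDAHA.exists_mulEquiv_closure_of_lift_injective StableDAHA.lift_fa_fb_injective
  rw [Matrix.range_cons_cons_empty] at hfree
  obtain ⟨e, he⟩ := hfree
  exact ⟨e, he 0, he 1⟩
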